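/- For a finite simple graph $H$ and positive integers $j,k$ such that $H$ has a proper $k$-coloring $V(H)\to\{1,\dots,k\}$, let $G^j_k(H)$ be the graph whose vertices are the proper $k$-colorings of $H$, two distinct colorings being adjacent if and only if $H$ contains a connected subgraph on at most $j$ vertices that contains all vertices where the two colorings differ. Let $g_k(H)$ be the least $j$ such that $G^j_k(H)$ is connected, and let $h_k(H)$ be the least $j$ such that $G^j_k(H)$ is Hamiltonian (contains a Hamiltonian cycle). Let $C_n$ denote the cycle on $n$ vertices and $K_{1,2m}$ the star with $2m$ leaves. Then: 1. $g_3(C_n)=2$ for every $n\ge 3$ with $n\ne 4$, and $g_3(C_4)=1$; 2. $h_3(C_n)=2$ for every $n\ge 3$, including $n=4$; 3. $g_3(K_{1,2m})=1$ and $h_3(K_{1,2m})=2$ for every $m\ge 1$. -/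

import Mathlib

/-- The `j`-localized `k`-coloring graph of a graph `H`: its vertices are the proper `k`-colorings
of `H`, and two distinct colorings are adjacent if `H` has a connected subgraph on at most `j`
vertices that contains all vertices where the colorings differ. -/
def localizedColoringGraph {V : Type*} (H : SimpleGraph V) (k j : ℕ) :
    SimpleGraph (H.Coloring (Fin k)) where
  Adj φ ψ := φ ≠ ψ ∧ ∃ F : H.Subgraph,
    F.Connected ∧ F.verts.encard ≤ (j : ℕ∞) ∧ ∀ v, φ v ≠ ψ v → v ∈ F.verts
  symm := by
    constructor
    rintro φ ψ ⟨hne, F, hF, hj, hv⟩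
    exact ⟨hne.symm, F, hF, hj, fun v h => hv v h.symm⟩
  loopless := by
    constructor
    rintro φ ⟨hne, _⟩
    exact hne rfl

/-- The `k`-color mixing number of `H`: the least `j` such that the `j`-localized
`k`-coloring graph of `H` is connected. A nonzero value of this infimum of natural numbers is
always attained; the value is `0` by convention if no such `j` exists. -/
noncomputable def colorMixingNumber {V : Type*} (H : SimpleGraph V) (k : ℕ) : ℕ :=
  sInf {j : ℕ | (localizedColoringGraph H k j).Connected}

open Classical in
/-- The `k`-color Gray code number of the finite graph `H`: the least `j` such that the
`j`-localized `k`-coloring graph of `H` is Hamiltonian. A nonzero value of this infimum of natural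
numbers is always attained; the value is `0` by convention if no such `j` exists. -/
noncomputable def colorGrayCodeNumber {V : Type*} [Fintype V] (H : SimpleGraph V) (k : ℕ) : ℕ :=
  sInf {j : ℕ | (localizedColoringGraph H k j).IsHamiltonian}

/-! `localizedColoringGraph` grows with `j` and Hamiltonian graphs are connected, so each value
follows from a construction at that `j` and an obstruction one step below.

Colourings of a cycle are cyclic words over three letters, and a step at `j = 2` may rewrite two
consecutive letters. Words of length at least 4 between two fixed letters form a Hamilton-connected
graph (`hamPath_properWords`): length 4 is a finite search, and the induction joins the two blocks
given by the first letter. Cyclic words split into three such blocks, which are linked in a ring.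
For a star with fixed centre colour the leaves form a hypercube; Hamiltonian paths between vertices
of opposite parity (`hamPath_cube`) are linked by changing the centre and one leaf together.

At `j = 1` the winding number of a cycle colouring is invariant, and for `n ≠ 4` it takes both a
nonzero value and its negative. On the four-cycle, the colourings using all three colours are
independent and too many for a Hamiltonian cycle. For an even star, a Hamiltonian cycle would
alternate a sign and hence never recolour the centre. -/

/-! ### Hamiltonian paths -/

/-- `HamPath r S x y`: the elements of `S` can be listed without repetition, starting with `x` and
ending with `y`, so that consecutive elements are related by `r`. -/
inductive HamPath {α : Type*} (r : α → α → Prop) : Set α → α → α → Prop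
  | single (x : α) : HamPath r {x} x x
  | cons {x y z : α} {S : Set α} : x ∉ S → r x y → HamPath r S y z → HamPath r (insert x S) x z

namespace HamPath

variable {α β : Type*} {r : α → α → Prop} {S T : Set α} {x y z w : α}

theorem left_mem (h : HamPath r S x y) : x ∈ S := by
  cases h <;> simp

theorem right_mem (h : HamPath r S x y) : y ∈ S := by
  induction h with
  | single => simp
  | cons _ _ _ ih => exact Or.inr ih

theorem eq_singleton (h : HamPath r S x x) : S = {x} := by
  cases h with
  | single => rfl
  | cons hx _ h => exact absurd h.right_mem hx

theorem append (h : HamPath r S x y) (hr : r y z) (h' : HamPath r T z w) (hd : Disjoint S T) :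
    HamPath r (S ∪ T) x w := by
  induction h with
  | single x => exact .cons (Set.disjoint_singleton_left.1 hd) hr h'
  | @cons x y _ S hx hxy _ ih =>
    rw [Set.insert_union]
    rw [Set.disjoint_insert_left] at hd
    exact .cons (by simp [hx, hd.1]) hxy (ih hr hd.2)

theorem map {r' : β → β → Prop} (f : α → β)
    (hf : ∀ a ∈ S, ∀ b ∈ S, f a = f b → a = b)
    (hr : ∀ a ∈ S, ∀ b ∈ S, r a b → r' (f a) (f b)) (h : HamPath r S x y) :
    HamPath r' (f '' S) (f x) (f y) := by
  induction h with
  | single x => rw [Set.image_singleton]; exact .single _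
  | @cons x y _ S hx hxy h ih =>
    rw [Set.image_insert_eq]
    refine .cons ?_ (hr _ (by simp) _ (Or.inr h.left_mem) hxy) ?_
    · rintro ⟨a, ha, hax⟩
      exact hx (hf a (Or.inr ha) x (by simp) hax ▸ ha)
    · exact ih (fun a ha b hb => hf a (Or.inr ha) b (Or.inr hb))
        fun a ha b hb => hr a (Or.inr ha) b (Or.inr hb)

/-- Pulls a path of words back to colourings along an injective code. Only distinct elements need be
related by `r'`, since `near` may be reflexive but adjacency is not. -/
theorem comap {r' : β → β → Prop} (g : β → α) (hg : Function.Injective g) (hS : S ⊆ Set.range g)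
    (hr : ∀ a b, a ≠ b → r (g a) (g b) → r' a b) {a b : β} (h : HamPath r S (g a) (g b)) :
    HamPath r' (g ⁻¹' S) a b := by
  generalize hx : g a = x at h
  generalize hy : g b = y at h
  induction h generalizing a with
  | single x =>
    have : a = b := hg (hx.trans hy.symm)
    subst this hx
    have : g ⁻¹' {g a} = {a} := by ext; simp [hg.eq_iff]
    rw [this]
    exact .single _
  | @cons x y _ S hxS hxy h ih =>
    obtain ⟨c, rfl⟩ := hS (Or.inr h.left_mem)
    subst hx
    have : g ⁻¹' (insert (g a) S) = insert a (g ⁻¹' S) := by ext; simp [hg.eq_iff]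
    rw [this]
    refine .cons hxS (hr _ _ ?_ hxy) (ih ((Set.subset_insert _ _).trans hS) rfl hy)
    rintro rfl
    exact hxS h.left_mem

/-- A Hamiltonian path can be cut at an edge outside of a relation `bad` that does not hold along
any path on three vertices. -/
theorem split {bad : α → α → Prop}
    (hbad : ∀ a ∈ S, ∀ b ∈ S, ∀ c ∈ S, a ≠ b → b ≠ c → a ≠ c → bad a b → bad b c → False)
    (hS : ∀ a b, S ≠ {a, b}) (hxy : x ≠ y) (h : HamPath r S x y) :
    ∃ S₁ S₂ u v, HamPath r S₁ x u ∧ HamPath r S₂ v y ∧ S₁ ∪ S₂ = S ∧ Disjoint S₁ S₂ ∧ r u v ∧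
      ¬ bad u v := by
  cases h with
  | single => exact absurd rfl hxy
  | @cons _ u _ S hx hxu h =>
    by_cases hb : bad x u
    · cases h with
      | single => exact absurd rfl (hS _ _)
      | @cons _ v _ S hu huv h =>
        have hxu' : x ≠ u := fun e => hx (by simp [e])
        have hxv' : x ≠ v := fun e => hx (by simp [e, h.left_mem])
        have huv' : u ≠ v := fun e => hu (e ▸ h.left_mem)
        refine ⟨{x, u}, S, u, v, .cons (by simpa using hxu') hxu (.single u), h, ?_, ?_, huv, ?_⟩
        · simp [Set.insert_union]
        · simp only [Set.disjoint_insert_left, Set.disjoint_singleton_left]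
          exact ⟨fun e => hx (by simp [e]), hu⟩
        · intro hb'
          exact hbad x (by simp) u (by simp) v (by simp [h.left_mem]) hxu' huv' hxv' hb hb'
    · exact ⟨{x}, S, x, u, .single x, h, by simp, by simpa using hx, hxu, hb⟩

theorem exists_isPath {G : SimpleGraph α} (h : HamPath G.Adj S x y) :
    ∃ p : G.Walk x y, p.IsPath ∧ ∀ v, v ∈ p.support ↔ v ∈ S := by
  induction h with
  | single x => exact ⟨.nil, .nil, by simp⟩
  | @cons x y _ S hx hxy _ ih =>
    obtain ⟨p, hp, hs⟩ := ih
    exact ⟨.cons hxy p, hp.cons (by rwa [hs]), by simp [hs]⟩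

end HamPath

/-- The edge from `y` to `x` closes the path; it could lie on the path only if the path had a single
edge, which the cardinality forbids. -/
theorem isHamiltonian_of_hamPath {α : Type*} [DecidableEq α] [Fintype α] {G : SimpleGraph α} {x y : α}
    (h : HamPath G.Adj Set.univ x y) (hyx : y ≠ x → G.Adj y x)
    (hc : 2 < Fintype.card α) : G.IsHamiltonian := by
  replace hyx : G.Adj y x := hyx fun hyx => by
    subst hyx
    have hs := h.eq_singleton
    have := Fintype.card_le_one_iff.2 fun a b => by
      have ha := Set.mem_univ a
      have hb := Set.mem_univ b
      rw [hs] at ha hb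
      exact ha.trans hb.symm
    omega
  obtain ⟨p, hp, hs⟩ := h.exists_isPath
  have hH : p.IsHamiltonian := hp.isHamiltonian_of_mem fun w => by simp [hs]
  intro _
  refine ⟨y, .cons hyx p, ?_⟩
  refine (SimpleGraph.Walk.isHamiltonianCycle_iff_isCycle_and_support_count_tail_eq_one).2 ⟨?_, ?_⟩
  · rw [SimpleGraph.Walk.cons_isCycle_iff]
    refine ⟨hp, fun he => ?_⟩
    have hl := hH.length_eq
    have h1 : p.length = 1 := by
      by_contra hne
      cases p with
      | nil => simp at he
      | @cons _ v _ hxz q =>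
        rw [SimpleGraph.Walk.cons_isPath_iff] at hp
        simp only [SimpleGraph.Walk.edges_cons, List.mem_cons] at he
        rcases he with he | he
        · have : y = v := by
            rcases Sym2.eq_iff.1 he with ⟨h1, _⟩ | ⟨h1, _⟩
            · exact absurd h1 hyx.ne
            · exact h1
          subst this
          cases q with
          | nil => simp at hne
          | cons h' q' =>
            have := ((SimpleGraph.Walk.cons_isPath_iff _ _).1 hp.1).2
            exact this q'.end_mem_support
        · exact hp.2 (q.snd_mem_support_of_mem_edges he)
    omega
  · simpa using fun a => hH a

/-! ### Gray codes for proper ternary words -/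

/-- Search for a Hamiltonian path from `x` to `y` whose interior consists of the elements of
`inner`, in `n` steps. -/
def searchPath {α : Type*} [DecidableEq α] (r : α → α → Bool) (y : α) : ℕ → List α → α → Bool
  | 0, inner, x => inner.isEmpty && r x y
  | n + 1, inner, x => inner.any fun z => r x z && searchPath r y n (inner.erase z) z

theorem hamPath_of_searchPath {α : Type*} [DecidableEq α] {r : α → α → Bool} {n : ℕ}
    {inner : List α} {x y : α} (h : searchPath r y n inner x) (hn : (x :: y :: inner).Nodup) :
    HamPath (fun a b => r a b) {a | a ∈ x :: y :: inner} x y := by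
  induction n generalizing inner x with
  | zero =>
    simp only [searchPath, Bool.and_eq_true, List.isEmpty_iff] at h
    obtain ⟨rfl, h⟩ := h
    have he : {a | a ∈ [x, y]} = insert x {y} := by ext; simp
    rw [he]
    exact .cons (by simpa using hn) h (.single y)
  | succ n ih =>
    simp only [searchPath, List.any_eq_true, Bool.and_eq_true] at h
    obtain ⟨z, hz, hxz, h⟩ := h
    rw [List.nodup_cons] at hn
    have hperm : (y :: inner).Perm (z :: y :: inner.erase z) :=
      ((List.perm_cons_erase hz).cons y).trans (.swap _ _ _)
    have := ih h (hperm.nodup_iff.1 hn.2)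
    have he : {a | a ∈ x :: y :: inner} = insert x {a | a ∈ z :: y :: inner.erase z} := by
      ext a
      simp only [Set.mem_ofPred_eq, List.mem_cons (b := x), Set.mem_insert_iff, hperm.mem_iff]
    rw [he]
    exact .cons (fun hx => hn.1 (hperm.mem_iff.2 hx)) hxz this

/-- The words of length `m` over three letters that yield a word with distinct consecutive letters
when put between the letters `s` and `e`. -/
def properWords : ℕ → Fin 3 → Fin 3 → List (List (Fin 3))
  | 0, s, e => if s = e then [] else [[]]
  | m + 1, s, e => (properWords m (s + 1) e).map (List.cons (s + 1)) ++
      (properWords m (s + 2) e).map (List.cons (s + 2))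

/-- Two words agree off two consecutive letters. -/
def near : List (Fin 3) → List (Fin 3) → Bool
  | a :: l, b :: m => decide (l.tail = m.tail) || (decide (a = b) && near l m)
  | _, _ => false

/-- The words of length four between the letters `0` and `d`, as numbers in base four. -/
def wordCodes : Fin 3 → List ℕ :=
  ![[73, 137, 153, 145, 97, 146, 98, 102, 70, 134],
    [137, 153, 25, 145, 17, 33, 146, 18, 34, 38, 134],
    [73, 25, 17, 33, 97, 18, 34, 98, 38, 102, 70]]

/-- The word of length four with the given code, with `s` added to its letters. -/
def decodeWord (s : Fin 3) (k : ℕ) : List (Fin 3) :=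
  [Fin.ofNat 3 (k % 4) + s, Fin.ofNat 3 (k / 4 % 4) + s, Fin.ofNat 3 (k / 16 % 4) + s,
    Fin.ofNat 3 (k / 64) + s]

/-- The codes of words of length four that agree off two consecutive letters. -/
def nearCode (a b : ℕ) : Bool :=
  (a / 16).beq (b / 16) || ((a % 4).beq (b % 4) && (a / 64).beq (b / 64)) || (a % 16).beq (b % 16)

/-- The finite base case. Subtracting the left letter normalizes it to `0`, so only the difference
`d` of the two boundary letters matters. -/
theorem searchPath_wordCodes : ∀ d, ∀ x ∈ wordCodes d, ∀ y ∈ wordCodes d, x ≠ y →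
    searchPath nearCode y ((wordCodes d).length - 2) (((wordCodes d).erase x).erase y) x := by
  decide +kernel

theorem map_decodeWord : ∀ s e, (wordCodes (e - s)).map (decodeWord s) = properWords 4 s e := by
  decide +kernel

theorem nodup_wordCodes : ∀ d, (wordCodes d).Nodup := by
  decide +kernel

theorem decodeWord_spec : ∀ s d, ∀ x ∈ wordCodes d, ∀ y ∈ wordCodes d,
    (decodeWord s x = decodeWord s y → x = y) ∧
    (nearCode x y → near (decodeWord s x) (decodeWord s y)) := by
  decide +kernel

theorem hamPath_properWords_four {s e : Fin 3} {x y : List (Fin 3)} (hx : x ∈ properWords 4 s e)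
    (hy : y ∈ properWords 4 s e) (hxy : x ≠ y) :
    HamPath (fun a b => near a b) {l | l ∈ properWords 4 s e} x y := by
  rw [← map_decodeWord] at hx hy ⊢
  obtain ⟨a, ha, rfl⟩ := List.mem_map.1 hx
  obtain ⟨b, hb, rfl⟩ := List.mem_map.1 hy
  have hab : a ≠ b := fun h => hxy (h ▸ rfl)
  have hperm : (wordCodes (e - s)).Perm (a :: b :: ((wordCodes (e - s)).erase a).erase b) :=
    (List.perm_cons_erase ha).trans
      ((List.perm_cons_erase ((List.mem_erase_of_ne hab.symm).2 hb)).cons a)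
  have h := hamPath_of_searchPath (searchPath_wordCodes _ a ha b hb hab)
    (hperm.nodup_iff.1 (nodup_wordCodes _))
  have he : {k | k ∈ a :: b :: ((wordCodes (e - s)).erase a).erase b} =
      {k | k ∈ wordCodes (e - s)} := by
    ext k
    exact hperm.mem_iff.symm
  rw [he] at h
  have := h.map (r' := fun a b => near a b) (decodeWord s)
    (fun p hp q hq => (decodeWord_spec s _ p hp q hq).1)
    (fun p hp q hq => (decodeWord_spec s _ p hp q hq).2)
  convert this using 1
  ext l
  exact List.mem_map

theorem cons_mem_properWords {m : ℕ} {s e a : Fin 3} {l : List (Fin 3)} :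
    a :: l ∈ properWords (m + 1) s e ↔ a ≠ s ∧ l ∈ properWords m a e := by
  have h : a ≠ s ↔ a = s + 1 ∨ a = s + 2 := by decide +revert
  rw [h]
  simp only [properWords, List.mem_append, List.mem_map, List.cons.injEq]
  constructor
  · rintro (⟨l, hl, rfl, rfl⟩ | ⟨l, hl, rfl, rfl⟩) <;> simp [hl]
  · rintro ⟨rfl | rfl, hl⟩
    · exact .inl ⟨l, hl, rfl, rfl⟩
    · exact .inr ⟨l, hl, rfl, rfl⟩

theorem exists_cons_of_mem_properWords {m : ℕ} {s e : Fin 3} {l : List (Fin 3)}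
    (h : l ∈ properWords (m + 1) s e) : ∃ a r, l = a :: r ∧ a ≠ s ∧ r ∈ properWords m a e := by
  cases l with
  | nil => simp [properWords] at h
  | cons a r => exact ⟨a, r, rfl, cons_mem_properWords.1 h⟩

theorem fin_three_add_one_ne : ∀ s : Fin 3, s + 1 ≠ s := by decide

theorem fin_three_exists_ne_ne : ∀ p q : Fin 3, ∃ c, c ≠ p ∧ q ≠ c := by decide

theorem fin_three_eq_or_eq : ∀ {s t t' a : Fin 3}, t ≠ s → t' ≠ s → t ≠ t' → a ≠ s →
    a = t ∨ a = t' := by decide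

/-- Used to cross between blocks away from both prescribed ends, and to ensure that a path to be cut
has two edges. -/
theorem exists_mem_properWords_ne {m : ℕ} (hm : 3 ≤ m) (s e : Fin 3) (p q : List (Fin 3)) :
    ∃ w ∈ properWords m s e, w ≠ p ∧ w ≠ q := by
  induction m, hm using Nat.le_induction generalizing s p q with
  | base =>
    have h : ∀ s e : Fin 3, 2 < (properWords 3 s e).toFinset.card := by decide
    by_contra! hc
    have hsub : (properWords 3 s e).toFinset ⊆ {p, q} := by
      intro w hw
      by_cases hp : w = p
      · simp [hp]
      · simp [hc w (List.mem_toFinset.1 hw) hp]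
    exact absurd ((Finset.card_le_card hsub).trans Finset.card_le_two) (by simpa using h s e)
  | succ m hm ih =>
    obtain ⟨w, hw, hp, hq⟩ := ih (s + 1) p.tail q.tail
    refine ⟨(s + 1) :: w, cons_mem_properWords.2 ⟨fin_three_add_one_ne s, hw⟩, ?_, ?_⟩
    · rintro rfl; exact hp rfl
    · rintro rfl; exact hq rfl

theorem near_of_tail_eq {a b : Fin 3} {l m : List (Fin 3)} (h : l.tail = m.tail) :
    near (a :: l) (b :: m) := by
  simp [near, h]

theorem near_cons {a : Fin 3} {l m : List (Fin 3)} (h : near l m) : near (a :: l) (a :: m) := by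
  simp [near, h]

theorem HamPath.map_cons {S : Set (List (Fin 3))} {x y : List (Fin 3)} (a : Fin 3)
    (h : HamPath (fun a b => near a b) S x y) :
    HamPath (fun a b => near a b) (List.cons a '' S) (a :: x) (a :: y) :=
  h.map _ (fun _ _ _ _ h => List.cons_injective h) fun _ _ _ _ h => near_cons h

theorem disjoint_image_cons {a b : Fin 3} (hab : a ≠ b) (S T : Set (List (Fin 3))) :
    Disjoint (List.cons a '' S) (List.cons b '' T) := by
  rw [Set.disjoint_left]
  rintro _ ⟨l, _, rfl⟩ ⟨m, _, h⟩
  exact hab (List.cons.inj h).1.symm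

/-- The first letter of a proper word may be replaced by another one that differs from a given
letter. -/
theorem exists_replace_head {m : ℕ} {s t e : Fin 3} {u : List (Fin 3)}
    (hu : u ∈ properWords (m + 2) s e) :
    ∃ v ∈ properWords (m + 2) t e, v.tail = u.tail := by
  obtain ⟨b, r, rfl, -, hr⟩ := exists_cons_of_mem_properWords hu
  obtain ⟨h, r, rfl, -, hr⟩ := exists_cons_of_mem_properWords hr
  obtain ⟨c, hct, hch⟩ : ∃ c, c ≠ t ∧ h ≠ c := fin_three_exists_ne_ne t h
  exact ⟨c :: h :: r, by simp [cons_mem_properWords, hct, hch, hr], rfl⟩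

theorem properWords_succ_eq {m : ℕ} {s e t t' : Fin 3} (ht : t ≠ s) (ht' : t' ≠ s) (htt : t ≠ t') :
    {l | l ∈ properWords (m + 1) s e} =
      List.cons t '' {l | l ∈ properWords m t e} ∪ List.cons t' '' {l | l ∈ properWords m t' e} := by
  ext l
  constructor
  · intro hl
    obtain ⟨a, r, rfl, ha, hr⟩ := exists_cons_of_mem_properWords hl
    have : a = t ∨ a = t' := fin_three_eq_or_eq ht ht' htt ha
    rcases this with rfl | rfl
    · exact .inl ⟨r, hr, rfl⟩
    · exact .inr ⟨r, hr, rfl⟩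
  · rintro (⟨r, hr, rfl⟩ | ⟨r, hr, rfl⟩)
    · exact cons_mem_properWords.2 ⟨ht, hr⟩
    · exact cons_mem_properWords.2 ⟨ht', hr⟩

/-- Any two distinct proper words are the ends of a Hamiltonian path. -/
theorem hamPath_properWords {m : ℕ} (hm : 4 ≤ m) (s e : Fin 3) {x y : List (Fin 3)}
    (hx : x ∈ properWords m s e) (hy : y ∈ properWords m s e) (hxy : x ≠ y) :
    HamPath (fun a b => near a b) {l | l ∈ properWords m s e} x y := by
  induction m, hm using Nat.le_induction generalizing s x y with
  | base => exact hamPath_properWords_four hx hy hxy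
  | succ m hm ih =>
    obtain ⟨k, rfl⟩ : ∃ k, m = k + 4 := ⟨m - 4, by omega⟩
    obtain ⟨t, x, rfl, ht, hx⟩ := exists_cons_of_mem_properWords hx
    obtain ⟨t', y, rfl, ht', hy⟩ := exists_cons_of_mem_properWords hy
    by_cases htt : t = t'
    -- Both ends lie in block `t`: cut its path at an edge `u`, `v` and insert all of block `t'`.
    -- Edges with `u.tail = v.tail` are avoided so that `u' ≠ v'`. Two of them never follow each
    -- other, as only two letters differ from `t`.
    · subst htt
      obtain ⟨t', ht', htt⟩ := fin_three_exists_ne_ne s t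
      have hxy : x ≠ y := fun h => hxy (h ▸ rfl)
      have hp := ih t hx hy hxy
      obtain ⟨S₁, S₂, u, v, h₁, h₂, hS, hd, -, hbad⟩ :=
        hp.split (bad := fun u v => u.tail = v.tail) (by
          intro a ha b hb c hc hab hbc hac h h'
          obtain ⟨a, r, rfl, hat, -⟩ := exists_cons_of_mem_properWords ha
          obtain ⟨b, r, rfl, hbt, -⟩ := exists_cons_of_mem_properWords hb
          obtain ⟨c, r, rfl, hct, -⟩ := exists_cons_of_mem_properWords hc
          simp only [List.tail_cons] at h h'
          subst h h'
          have hab : a ≠ b := fun h => hab (h ▸ rfl)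
          have hbc : b ≠ c := fun h => hbc (h ▸ rfl)
          have hac : a ≠ c := fun h => hac (h ▸ rfl)
          exact (fin_three_eq_or_eq hat hbt hab hct).elim (fun h => hac h.symm) fun h => hbc h.symm)
          (by
          intro a b h
          obtain ⟨w, hw, hwa, hwb⟩ := exists_mem_properWords_ne (m := k + 4) (by omega) t e a b
          have : w ∈ ({a, b} : Set _) := h ▸ hw
          rcases this with rfl | rfl
          · exact hwa rfl
          · exact hwb rfl) hxy
      have hu : u ∈ properWords (k + 2 + 2) t e := by
        have : u ∈ S₁ ∪ S₂ := .inl h₁.right_mem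
        rwa [hS] at this
      have hv : v ∈ properWords (k + 2 + 2) t e := by
        have : v ∈ S₁ ∪ S₂ := .inr h₂.left_mem
        rwa [hS] at this
      obtain ⟨u', hu', hut⟩ := exists_replace_head (t := t') hu
      obtain ⟨v', hv', hvt⟩ := exists_replace_head (t := t') hv
      have huv : u' ≠ v' := by
        rintro rfl
        exact hbad (hut.symm.trans hvt)
      have h := ((h₁.map_cons t).append (near_of_tail_eq hut.symm) ((ih t' hu' hv' huv).map_cons t')
        (disjoint_image_cons htt _ _)).append (near_of_tail_eq hvt) (h₂.map_cons t) (by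
          rw [Set.disjoint_union_left]
          refine ⟨(Set.disjoint_image_iff List.cons_injective).2 hd, ?_⟩
          exact disjoint_image_cons htt.symm _ _)
      rw [properWords_succ_eq ht ht' htt, ← hS, Set.image_union]
      convert h using 1
      exact Set.union_right_comm _ _ _
    · rw [properWords_succ_eq ht ht' htt]
      -- The ends lie in different blocks. The letter `s` may follow both `t` and `t'`, so the path
      -- crosses at `s :: w`.
      obtain ⟨w, hw, hwx, hwy⟩ :=
        exists_mem_properWords_ne (m := k + 3) (by omega) s e x.tail y.tail
      refine ((ih t hx (y := s :: w) ?_ ?_).map_cons t).append (near_of_tail_eq rfl)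
        ((ih t' (x := s :: w) ?_ hy ?_).map_cons t') (disjoint_image_cons htt _ _)
      · exact cons_mem_properWords.2 ⟨ht.symm, hw⟩
      · rintro rfl; exact hwx rfl
      · exact cons_mem_properWords.2 ⟨ht'.symm, hw⟩
      · rintro rfl; exact hwy rfl

/-- For a letter `a` there is a word that starts with `a` and fits between any letters other
than `a`. -/
theorem exists_common_properWord {m : ℕ} (hm : 3 ≤ m) (a : Fin 3) :
    ∃ l, ∀ s e, s ≠ a → e ≠ a → a :: l ∈ properWords m s e := by
  obtain ⟨k, rfl⟩ : ∃ k, m = k + 3 := ⟨m - 3, by omega⟩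
  -- The words built here also end in `a`. Prefixing `a`, `a + 1` preserves this and adds two
  -- letters, hence one base case per parity.
  induction k using Nat.twoStepInduction with
  | zero => exact ⟨[a + 1, a], by decide +revert⟩
  | one => exact ⟨[a + 1, a + 2, a], by decide +revert⟩
  | more k ih _ =>
    obtain ⟨l, hl⟩ := ih (by omega)
    refine ⟨(a + 1) :: a :: l, fun s e hs he => ?_⟩
    have ha := fin_three_add_one_ne a
    exact cons_mem_properWords.2 ⟨hs.symm, cons_mem_properWords.2 ⟨ha, hl _ _ ha he⟩⟩

/-- The words of length `m + 1` that are proper when read cyclically. -/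
def cyclicWords (m : ℕ) : Set (List (Fin 3)) :=
  {l | ∃ c w, w ∈ properWords m c c ∧ l = c :: w}

/-- One passes from block `a` to block `b` at the remainder `c :: f c`, with `c` the third letter,
which is proper in both blocks. The three passages have different remainders and close up in a ring.
-/
theorem hamPath_cyclicWords_of_four_le {m : ℕ} (hm : 4 ≤ m) :
    ∃ x y, HamPath (fun a b => near a b) (cyclicWords m) x y ∧ near y x := by
  choose f hf using fun a => exists_common_properWord (m := m) (by omega) a
  have hblock : ∀ a b c : Fin 3, a ≠ b → a ≠ c → b ≠ c →
      HamPath (fun a b => near a b) (List.cons a '' {l | l ∈ properWords m a a})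
        (a :: b :: f b) (a :: c :: f c) := fun a b c hab hac hbc =>
    (hamPath_properWords hm a a (hf b a a hab hab) (hf c a a hac hac)
      fun h => hbc (List.cons.inj h).1).map_cons a
  refine ⟨0 :: 1 :: f 1, 2 :: 1 :: f 1, ?_, near_of_tail_eq rfl⟩
  · convert ((hblock 0 1 2 (by decide) (by decide) (by decide)).append (near_of_tail_eq rfl)
      (hblock 1 2 0 (by decide) (by decide) (by decide)) (disjoint_image_cons (by decide) _ _)).append
      (near_of_tail_eq rfl) (hblock 2 0 1 (by decide) (by decide) (by decide)) (by
        rw [Set.disjoint_union_left]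
        exact ⟨disjoint_image_cons (by decide) _ _, disjoint_image_cons (by decide) _ _⟩) using 1
    ext l
    constructor
    · rintro ⟨c, w, hw, rfl⟩
      have : ∀ c : Fin 3, c = 0 ∨ c = 1 ∨ c = 2 := by decide
      rcases this c with rfl | rfl | rfl
      · exact .inl (.inl ⟨w, hw, rfl⟩)
      · exact .inl (.inr ⟨w, hw, rfl⟩)
      · exact .inr ⟨w, hw, rfl⟩
    · rintro ((⟨w, hw, rfl⟩ | ⟨w, hw, rfl⟩) | ⟨w, hw, rfl⟩) <;> exact ⟨_, w, hw, rfl⟩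

/-- The list of cyclically proper words of length `m + 1`. -/
def cyclicWordList (m : ℕ) : List (List (Fin 3)) :=
  [0, 1, 2].flatMap fun c => (properWords m c c).map (List.cons c)

theorem hamPath_cyclicWords {m : ℕ} (hm : 2 ≤ m) :
    ∃ x y, HamPath (fun a b => near a b) (cyclicWords m) x y ∧ near y x := by
  have key : ∀ x y inner n, (cyclicWordList m).Perm (x :: y :: inner) → (x :: y :: inner).Nodup →
      searchPath near y n inner x → near y x →
      ∃ x y, HamPath (fun a b => near a b) (cyclicWords m) x y ∧ near y x := by
    intro x y inner n hp hn hs hyx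
    refine ⟨x, y, ?_, hyx⟩
    convert hamPath_of_searchPath hs hn using 1
    ext l
    rw [Set.mem_ofPred_eq, ← hp.mem_iff]
    simp only [cyclicWords, cyclicWordList, Set.mem_ofPred_eq, List.mem_flatMap, List.mem_map]
    constructor
    · have : ∀ c : Fin 3, c ∈ [0, 1, 2] := by decide
      rintro ⟨c, w, hw, rfl⟩
      exact ⟨c, this c, w, hw, rfl⟩
    · rintro ⟨c, -, w, hw, rfl⟩
      exact ⟨c, w, hw, rfl⟩
  rcases Nat.lt_or_ge m 4 with h | h
  -- Cycles of length 3 and 4 have 6 and 18 colourings, leaving 4 and 16 interior vertices for the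
  -- search.
  · interval_cases m
    · exact key [0, 1, 2] [1, 0, 2] (((cyclicWordList 2).erase [0, 1, 2]).erase [1, 0, 2]) 4
        (by decide +kernel) (by decide +kernel) (by decide +kernel) (by decide)
    · exact key [0, 1, 2, 1] [2, 1, 2, 1]
        (((cyclicWordList 3).erase [0, 1, 2, 1]).erase [2, 1, 2, 1]) 16
        (by decide +kernel) (by decide +kernel) (by decide +kernel) (by decide)
  · exact hamPath_cyclicWords_of_four_le h

/-! ### Localized colouring graphs for small `j` -/

section LocalizedColoringGraph

variable {V : Type*} {H : SimpleGraph V} {k : ℕ} {φ ψ : H.Coloring (Fin k)}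

theorem localizedColoringGraph_mono {i j : ℕ} (h : i ≤ j) :
    localizedColoringGraph H k i ≤ localizedColoringGraph H k j := by
  rintro φ ψ ⟨hne, F, hF, hi, hv⟩
  exact ⟨hne, F, hF, hi.trans (by exact_mod_cast h), hv⟩

theorem localizedColoringGraph_two_adj {u v : V} (huv : H.Adj u v) (hne : φ ≠ ψ)
    (h : ∀ w, φ w ≠ ψ w → w = u ∨ w = v) : (localizedColoringGraph H k 2).Adj φ ψ :=
  ⟨hne, H.subgraphOfAdj huv, SimpleGraph.Subgraph.subgraphOfAdj_connected huv,
    by rw [SimpleGraph.subgraphOfAdj_verts, Set.encard_pair huv.ne]; rfl, h⟩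

theorem localizedColoringGraph_one_adj {v : V} (hne : φ ≠ ψ) (h : ∀ w, φ w ≠ ψ w → w = v) :
    (localizedColoringGraph H k 1).Adj φ ψ :=
  ⟨hne, H.singletonSubgraph v, SimpleGraph.Subgraph.singletonSubgraph_connected,
    by simp, h⟩

theorem localizedColoringGraph_one_reachable {v : V} (h : ∀ w, φ w ≠ ψ w → w = v) :
    (localizedColoringGraph H k 1).Reachable φ ψ := by
  by_cases hne : φ = ψ
  · rw [hne]
  · exact (localizedColoringGraph_one_adj hne h).reachable

theorem exists_of_localizedColoringGraph_one_adj (h : (localizedColoringGraph H k 1).Adj φ ψ) :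
    ∃ v, φ v ≠ ψ v ∧ ∀ w, w ≠ v → φ w = ψ w := by
  obtain ⟨hne, F, -, h1, hv⟩ := h
  obtain ⟨v, hvne⟩ : ∃ v, φ v ≠ ψ v := by
    by_contra! hc
    exact hne (DFunLike.ext _ _ hc)
  refine ⟨v, hvne, fun w hw => ?_⟩
  by_contra hc
  exact hw (Set.encard_le_one_iff.1 (by simpa using h1) w v (hv w hc) (hv v hvne))

/-- A connected subgraph has a vertex. -/
theorem localizedColoringGraph_zero : localizedColoringGraph H k 0 = ⊥ := by
  ext φ ψ
  simp only [SimpleGraph.bot_adj, iff_false]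
  rintro ⟨-, F, hF, h0, -⟩
  obtain ⟨v, hv⟩ := hF.nonempty
  simp only [Nat.cast_zero, nonpos_iff_eq_zero, Set.encard_eq_zero] at h0
  simp [h0] at hv

theorem colorMixingNumber_eq_two (h : (localizedColoringGraph H k 2).Connected)
    (h1 : ¬ (localizedColoringGraph H k 1).Connected) : colorMixingNumber H k = 2 := by
  refine le_antisymm (Nat.sInf_le h) (le_csInf ⟨2, h⟩ fun j hj => ?_)
  by_contra hlt
  exact h1 (hj.mono (localizedColoringGraph_mono (by omega)))

theorem colorMixingNumber_eq_one (h : (localizedColoringGraph H k 1).Connected)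
    (hne : φ ≠ ψ) : colorMixingNumber H k = 1 := by
  refine le_antisymm (Nat.sInf_le h) (le_csInf ⟨1, h⟩ fun j hj => ?_)
  by_contra hlt
  obtain rfl : j = 0 := by omega
  have hj : (localizedColoringGraph H k 0).Connected := hj
  rw [localizedColoringGraph_zero] at hj
  exact hne (SimpleGraph.reachable_bot.1 (hj.preconnected φ ψ))

open Classical in
theorem colorGrayCodeNumber_eq_two [Fintype V]
    (h : (localizedColoringGraph H k 2).IsHamiltonian)
    (h1 : ¬ (localizedColoringGraph H k 1).IsHamiltonian) : colorGrayCodeNumber H k = 2 := by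
  refine le_antisymm (Nat.sInf_le h) (le_csInf ⟨2, h⟩ fun j hj => ?_)
  by_contra hlt
  exact h1 (SimpleGraph.IsHamiltonian.mono (localizedColoringGraph_mono (by omega)) hj)

/-- The colouring obtained by a cyclic shift of the three colours. -/
def shiftColoring (φ : H.Coloring (Fin 3)) (c : Fin 3) : H.Coloring (Fin 3) :=
  SimpleGraph.Coloring.mk (fun v => φ v + c) fun h => by simpa using φ.valid h

/-- The three cyclic shifts of one colouring are distinct. -/
theorem two_lt_card_coloring [Nonempty V] [Fintype (H.Coloring (Fin 3))]
    (φ : H.Coloring (Fin 3)) : 2 < Fintype.card (H.Coloring (Fin 3)) := by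
  have hinj : Function.Injective (shiftColoring φ) := fun a b h =>
    add_left_cancel (DFunLike.congr_fun h (Classical.arbitrary V) :)
  exact Nat.lt_of_succ_le (by simpa using Fintype.card_le_of_injective _ hinj)

end LocalizedColoringGraph

/-! ### Colourings of cycles as cyclic words -/

section CycleColorings

variable {m : ℕ}

/-- The colouring of a cycle given by a cyclic sequence with distinct consecutive terms. -/
def cycleColoring (f : Fin (m + 2) → Fin 3) (hf : ∀ i, f i ≠ f (i + 1)) :
    (SimpleGraph.cycleGraph (m + 2)).Coloring (Fin 3) :=
  SimpleGraph.Coloring.mk f fun {u v} h => by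
    rcases SimpleGraph.cycleGraph_adj.1 h with h | h
    · rw [sub_eq_iff_eq_add'] at h
      subst h
      exact (hf v).symm
    · rw [sub_eq_iff_eq_add'] at h
      subst h
      exact hf u

theorem cycleColoring_apply (f : Fin (m + 2) → Fin 3) (hf : ∀ i, f i ≠ f (i + 1))
    (i : Fin (m + 2)) : cycleColoring f hf i = f i := rfl

theorem cycleGraph_adj_add_one (i : Fin (m + 2)) :
    (SimpleGraph.cycleGraph (m + 2)).Adj i (i + 1) :=
  SimpleGraph.cycleGraph_adj.2 (.inr (by simp))

theorem mem_properWords_iff {s e : Fin 3} {l : List (Fin 3)} :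
    l ∈ properWords m s e ↔ l.length = m ∧ (s :: (l ++ [e])).IsChain (· ≠ ·) := by
  induction m generalizing s l with
  | zero =>
    cases l with
    | nil => by_cases h : s = e <;> simp [properWords, h]
    | cons => simp [properWords]
  | succ m ih =>
    cases l with
    | nil => simp [properWords]
    | cons a l =>
      rw [cons_mem_properWords, ih]
      simp only [List.length_cons, Nat.add_right_cancel_iff, List.cons_append,
        List.isChain_cons_cons, ne_comm (a := a)]
      tauto

theorem ofFn_mem_cyclicWords_iff {f : Fin (m + 2) → Fin 3} :
    List.ofFn f ∈ cyclicWords (m + 1) ↔ ∀ i, f i ≠ f (i + 1) := by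
  have h1 : List.ofFn f ∈ cyclicWords (m + 1) ↔
      (List.ofFn f ++ [f 0]).IsChain (· ≠ ·) := by
    rw [List.ofFn_succ]
    constructor
    · rintro ⟨c, w, hw, h⟩
      obtain ⟨rfl, rfl⟩ := List.cons.inj h
      exact (mem_properWords_iff.1 hw).2
    · intro h
      exact ⟨f 0, _, mem_properWords_iff.2 ⟨by simp, h⟩, rfl⟩
  rw [h1, List.isChain_iff_getElem]
  simp only [List.length_append, List.length_ofFn, List.length_singleton]
  constructor
  · intro h i
    have := h i (by omega)
    by_cases hi : (i : ℕ) + 1 < m + 2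
    · rw [List.getElem_append_left (by rw [List.length_ofFn]; omega),
        List.getElem_append_left (by simpa using hi)] at this
      simp only [List.getElem_ofFn] at this
      convert this
      rw [Fin.val_add_one_of_lt' hi]
    · have hl : i = Fin.last (m + 1) := Fin.ext (by simp; omega)
      subst hl
      rw [List.getElem_append_left (by simp), List.getElem_append_right (by simp)] at this
      simp only [List.getElem_ofFn, List.length_ofFn, Fin.val_last, List.getElem_singleton] at this
      rwa [Fin.last_add_one]
  · intro h i hi
    by_cases hi' : i + 1 < m + 2
    · rw [List.getElem_append_left (by simp; omega), List.getElem_append_left (by simpa using hi')]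
      simp only [List.getElem_ofFn]
      convert h ⟨i, by omega⟩
      exact (Fin.val_add_one_of_lt' (i := ⟨i, by omega⟩) hi').symm
    · obtain rfl : i = m + 1 := by omega
      rw [List.getElem_append_left (by simp), List.getElem_append_right (by simp)]
      have := h (Fin.last (m + 1))
      rw [Fin.last_add_one] at this
      simp only [List.getElem_ofFn, List.getElem_singleton]
      exact this

theorem length_of_mem_cyclicWords {l : List (Fin 3)} (h : l ∈ cyclicWords m) :
    l.length = m + 1 := by
  obtain ⟨c, w, hw, rfl⟩ := h
  simp [(mem_properWords_iff.1 hw).1]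

theorem exists_of_near {l l' : List (Fin 3)} (h : near l l') :
    ∃ k < l.length, ∀ i, i ≠ k → i ≠ k + 1 → l[i]? = l'[i]? := by
  induction l generalizing l' with
  | nil => simp [near] at h
  | cons a l ih =>
    cases l' with
    | nil => simp [near] at h
    | cons b l' =>
      simp only [near, Bool.or_eq_true, decide_eq_true_eq, Bool.and_eq_true] at h
      rcases h with h | ⟨rfl, h⟩
      · refine ⟨0, by simp, fun i h0 h1 => ?_⟩
        obtain ⟨j, rfl⟩ : ∃ j, i = j + 2 := ⟨i - 2, by omega⟩
        simpa using congrArg (fun t : List (Fin 3) => t[j]?) h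
      · obtain ⟨k, hk, h⟩ := ih h
        refine ⟨k + 1, by simpa using hk, fun i h0 h1 => ?_⟩
        cases i with
        | zero => simp
        | succ i => simpa using h i (by omega) (by omega)

theorem localizedColoringGraph_two_adj_of_near
    {φ ψ : (SimpleGraph.cycleGraph (m + 2)).Coloring (Fin 3)} (hne : φ ≠ ψ)
    (h : near (List.ofFn φ) (List.ofFn ψ)) :
    (localizedColoringGraph (SimpleGraph.cycleGraph (m + 2)) 3 2).Adj φ ψ := by
  obtain ⟨k, hk, h⟩ := exists_of_near h
  rw [List.length_ofFn] at hk
  -- If `k` is the last index, `k + 1` wraps to `0`; this is harmless, since then only the letter at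
  -- `k` can change.
  refine localizedColoringGraph_two_adj (cycleGraph_adj_add_one ⟨k, hk⟩) hne fun w hw => ?_
  by_contra! hc
  have h1 : (w : ℕ) ≠ k := fun e => hc.1 (Fin.ext e)
  have h2 : (w : ℕ) ≠ k + 1 := by
    intro e
    refine hc.2 (Fin.ext ?_)
    rw [Fin.val_add_one_of_lt' (i := ⟨k, hk⟩) (by simp; omega)]
    exact e
  have := h w h1 h2
  simp only [List.getElem?_ofFn, w.isLt, dite_true] at this
  exact hw (by simpa using this)

open Classical in
theorem isHamiltonian_localizedColoringGraph_cycleGraph (hm : 1 ≤ m) :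
    (localizedColoringGraph (SimpleGraph.cycleGraph (m + 2)) 3 2).IsHamiltonian := by
  obtain ⟨x, y, h, hyx⟩ := hamPath_cyclicWords (m := m + 1) (by omega)
  set g : (SimpleGraph.cycleGraph (m + 2)).Coloring (Fin 3) → List (Fin 3) :=
    fun φ => List.ofFn φ with hg
  have hinj : Function.Injective g := fun φ ψ h => DFunLike.coe_injective (List.ofFn_injective h)
  have hrange : cyclicWords (m + 1) ⊆ Set.range g := by
    intro l hl
    have hlen : l.length = m + 2 := length_of_mem_cyclicWords hl
    have he : List.ofFn (fun i : Fin (m + 2) => l[(i : ℕ)]) = l :=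
      List.ext_getElem (by rw [List.length_ofFn, hlen])
        fun i _ _ => by rw [List.getElem_ofFn]
    rw [← he] at hl
    exact ⟨cycleColoring _ (ofFn_mem_cyclicWords_iff.1 hl), he⟩
  have huniv : g ⁻¹' cyclicWords (m + 1) = Set.univ :=
    Set.eq_univ_of_forall fun φ =>
      ofFn_mem_cyclicWords_iff.2 fun i => φ.valid (cycleGraph_adj_add_one i)
  obtain ⟨φ, rfl⟩ := hrange h.left_mem
  obtain ⟨ψ, rfl⟩ := hrange h.right_mem
  have hp := h.comap (r' := (localizedColoringGraph (SimpleGraph.cycleGraph (m + 2)) 3 2).Adj) g hinj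
    hrange fun a b hab hn => localizedColoringGraph_two_adj_of_near hab hn
  rw [huniv] at hp
  exact isHamiltonian_of_hamPath hp
    (fun hne => localizedColoringGraph_two_adj_of_near hne hyx)
    (two_lt_card_coloring φ)

end CycleColorings

/-! ### The winding number obstruction -/

section Winding

variable {m : ℕ}

/-- The signed step of a colour difference. -/
def colorStep : Fin 3 → ℤ := ![0, 1, -1]

/-- The winding number of a cyclic sequence of colours, times three. -/
def winding (f : Fin (m + 2) → Fin 3) : ℤ := ∑ i, colorStep (f (i + 1) - f i)

/-- Two neighbours that both avoid `a` and `b` have the same colour, so the steps into and out of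
the middle vertex cancel. -/
theorem colorStep_add_eq : ∀ p q a b : Fin 3, a ≠ b ∧ p ≠ a ∧ p ≠ b ∧ q ≠ a ∧ q ≠ b →
    colorStep (a - p) - colorStep (b - p) + (colorStep (q - a) - colorStep (q - b)) = 0 := by
  decide

theorem winding_eq_of_adj {φ ψ : (SimpleGraph.cycleGraph (m + 2)).Coloring (Fin 3)}
    (h : (localizedColoringGraph (SimpleGraph.cycleGraph (m + 2)) 3 1).Adj φ ψ) :
    winding φ = winding ψ := by
  obtain ⟨v, hv, h⟩ := exists_of_localizedColoringGraph_one_adj h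
  have h1 : v - 1 ≠ v := by simp
  have h2 : v + 1 ≠ v := by simp
  have hp := (SimpleGraph.cycleGraph_adj (n := m)).2 (.inr (sub_sub_cancel v 1) :
    v - 1 - v = 1 ∨ v - (v - 1) = 1)
  have hq := cycleGraph_adj_add_one v
  rw [← sub_eq_zero, winding, winding, ← Finset.sum_sub_distrib,
    Fintype.sum_eq_add (v - 1) v h1, sub_add_cancel, h _ h1, h _ h2]
  · have e1 := φ.valid hp
    have e2 := ψ.valid hp
    have e3 := φ.valid hq
    have e4 := ψ.valid hq
    rw [h _ h1] at e1
    rw [h _ h2] at e3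
    exact colorStep_add_eq _ _ _ _ ⟨hv, e1, e2, e3.symm, e4.symm⟩
  · rintro i ⟨hi1, hi2⟩
    have : i + 1 ≠ v := fun e => hi1 (by rw [← e, add_sub_cancel_right])
    rw [h _ hi2, h _ this, sub_self]

/-- The colour of an integer height. -/
def heightColor (z : ℤ) : Fin 3 := (z : ZMod 3)

theorem heightColor_sub (a b : ℤ) : heightColor a - heightColor b = heightColor (a - b) :=
  (Int.cast_sub (R := ZMod 3) a b).symm

theorem colorStep_heightColor {a b : ℤ} (h : a - b = 1 ∨ a - b = -1) :
    colorStep (heightColor a - heightColor b) = a - b := by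
  rw [heightColor_sub]
  rcases h with h | h <;> rw [h] <;> rfl

/-- Heights modulo 3 give the colours; divisibility of the last height closes the cycle, and the
steps telescope. -/
theorem exists_coloring_winding_eq {h : ℕ → ℤ} (h0 : h 0 = 0)
    (hs : ∀ i, h (i + 1) - h i = 1 ∨ h (i + 1) - h i = -1) (hn : 3 ∣ h (m + 2)) :
    ∃ φ : (SimpleGraph.cycleGraph (m + 2)).Coloring (Fin 3), winding φ = h (m + 2) := by
  have hwrap : ∀ i : Fin (m + 2), heightColor (h ((i + 1 : Fin (m + 2)) : ℕ)) =
      heightColor (h (i + 1)) := by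
    intro i
    by_cases hi : (i : ℕ) + 1 < m + 2
    · rw [Fin.val_add_one_of_lt' hi]
    · obtain rfl : i = Fin.last (m + 1) := Fin.ext (by simp; omega)
      rw [Fin.last_add_one, Fin.val_last, Fin.val_zero, h0]
      exact ((ZMod.intCast_zmod_eq_zero_iff_dvd _ 3).2 hn).symm
  refine ⟨cycleColoring (fun i => heightColor (h i)) fun i hi => ?_, ?_⟩
  · have := colorStep_heightColor (hs i)
    rw [← hwrap, ← hi, sub_self] at this
    rcases hs i with h | h <;> rw [h] at this <;> simp [colorStep] at this
  · have : ∀ i : Fin (m + 2), colorStep (heightColor (h ((i + 1 : Fin (m + 2)) : ℕ)) -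
        heightColor (h i)) = h (i + 1) - h i := fun i => by
      rw [hwrap, colorStep_heightColor (hs i)]
    simp only [winding, cycleColoring_apply, this]
    rw [Fin.sum_univ_eq_sum_range (fun i => h (i + 1) - h i), Finset.sum_range_sub, h0, sub_zero]

theorem not_connected_cycleGraph_of_height {h : ℕ → ℤ} (h0 : h 0 = 0)
    (hs : ∀ i, h (i + 1) - h i = 1 ∨ h (i + 1) - h i = -1) (hn : 3 ∣ h (m + 2))
    (hne : h (m + 2) ≠ 0) :
    ¬ (localizedColoringGraph (SimpleGraph.cycleGraph (m + 2)) 3 1).Connected := by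
  intro hc
  obtain ⟨φ, hφ⟩ := exists_coloring_winding_eq h0 hs hn
  obtain ⟨ψ, hψ⟩ := exists_coloring_winding_eq (m := m) (h := fun i => -h i) (by simp [h0])
    (fun i => by have := hs i; omega) (by simpa using hn)
  obtain ⟨p⟩ := hc.preconnected φ ψ
  have : winding φ = winding ψ := by
    clear hφ hψ
    induction p with
    | nil => rfl
    | cons h _ ih => exact (winding_eq_of_adj h).trans ih
  omega

theorem not_connected_cycleGraph (hm : 1 ≤ m) (hm2 : m ≠ 2) :
    ¬ (localizedColoringGraph (SimpleGraph.cycleGraph (m + 2)) 3 1).Connected := by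
  -- The height climbs to `q`, then zigzags between `q` and `q + 1`, and equal parity brings it back
  -- to `q`. For even `n` the choice `q = 6` needs `n ≥ 6`, which excludes `n = 4`.
  obtain ⟨q, hq, hqm, hpar⟩ : ∃ q : ℕ, 3 ∣ q ∧ (0 < q ∧ q ≤ m + 2) ∧ (m + 2 - q) % 2 = 0 := by
    rcases Nat.even_or_odd' m with ⟨k, rfl | rfl⟩
    · exact ⟨6, by norm_num, by omega, by omega⟩
    · exact ⟨3, by norm_num, by omega, by omega⟩
  have hend : (if m + 2 ≤ q then ((m + 2 : ℕ) : ℤ) else q + ((m + 2 - q) % 2 : ℕ)) = q := by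
    split_ifs <;> omega
  refine not_connected_cycleGraph_of_height
    (h := fun i => if i ≤ q then (i : ℤ) else q + ((i - q) % 2 : ℕ)) (by simp) ?_ ?_ ?_
  · intro i
    split_ifs <;> omega
  · rw [hend]; exact_mod_cast hq
  · rw [hend]; omega

end Winding

/-! ### Connectedness for the four-cycle -/

/-- If vertices are indexed by pairs of distinct colours, and pairs that share a component are
joined by walks, then all of them are. -/
theorem reachable_of_pairs {α : Type*} {G : SimpleGraph α} (M : (a b : Fin 3) → a ≠ b → α)
    (hright : ∀ a b c hab hac, G.Reachable (M a b hab) (M a c hac))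
    (hleft : ∀ a b c hab hcb, G.Reachable (M a b hab) (M c b hcb)) (a b : Fin 3) (hab : a ≠ b) :
    G.Reachable (M a b hab) (M 0 1 (by decide)) := by
  have h01 : (0 : Fin 3) ≠ 1 := by decide
  by_cases ha : a = 0
  · subst ha; exact hright 0 b 1 hab h01
  by_cases hb : b = 0
  · subst hb
    have : ∀ a : Fin 3, a ≠ 0 → a ≠ a + a ∧ 0 ≠ a + a := by decide
    obtain ⟨h1, h2⟩ := this a ha
    exact ((hright a 0 (a + a) ha h1).trans (hleft _ _ 0 _ h2)).trans (hright 0 _ 1 _ h01)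
  · exact (hleft a b 0 hab (Ne.symm hb)).trans (hright 0 _ 1 _ h01)

section FourCycle

theorem cycleGraph_four_ne_iff {f : Fin 4 → Fin 3} : (∀ i, f i ≠ f (i + 1)) ↔
    f 0 ≠ f 1 ∧ f 1 ≠ f 2 ∧ f 2 ≠ f 3 ∧ f 3 ≠ f 0 := by
  simp [Fin.forall_fin_succ]

theorem connected_cycleGraph_four :
    (localizedColoringGraph (SimpleGraph.cycleGraph 4) 3 1).Connected := by
  set G := localizedColoringGraph (SimpleGraph.cycleGraph 4) 3 1
  have hval : ∀ φ : (SimpleGraph.cycleGraph 4).Coloring (Fin 3), ∀ i, φ i ≠ φ (i + 1) :=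
    fun φ i => φ.valid (cycleGraph_adj_add_one (m := 2) i)
  let M : (a b : Fin 3) → a ≠ b → (SimpleGraph.cycleGraph 4).Coloring (Fin 3) := fun a b hab =>
    cycleColoring (m := 2) ![a, b, a, b] (cycleGraph_four_ne_iff.2 ⟨hab, hab.symm, hab, hab.symm⟩)
  have hright : ∀ a b c hab hac, G.Reachable (M a b hab) (M a c hac) := by
    intro a b c hab hac
    let N : (SimpleGraph.cycleGraph 4).Coloring (Fin 3) := cycleColoring (m := 2) ![a, b, a, c]
      (cycleGraph_four_ne_iff.2 ⟨hab, hab.symm, hac, hac.symm⟩)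
    exact (localizedColoringGraph_one_reachable (ψ := N) (v := 3)
      (by intro w; fin_cases w <;> simp [M, N, cycleColoring_apply])).trans
      (localizedColoringGraph_one_reachable (v := 1)
      (by intro w; fin_cases w <;> simp [M, N, cycleColoring_apply]))
  have hleft : ∀ a b c hab hcb, G.Reachable (M a b hab) (M c b hcb) := by
    intro a b c hab hcb
    let N : (SimpleGraph.cycleGraph 4).Coloring (Fin 3) := cycleColoring (m := 2) ![a, b, c, b]
      (cycleGraph_four_ne_iff.2 ⟨hab, hcb.symm, hcb, hab.symm⟩)
    exact (localizedColoringGraph_one_reachable (ψ := N) (v := 2)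
      (by intro w; fin_cases w <;> simp [M, N, cycleColoring_apply])).trans
      (localizedColoringGraph_one_reachable (v := 0)
      (by intro w; fin_cases w <;> simp [M, N, cycleColoring_apply]))
  have hM := reachable_of_pairs M hright hleft
  have hbase : ∀ φ, G.Reachable φ (M 0 1 (by decide)) := by
    intro φ
    obtain ⟨h01, h12, h23, h30⟩ := cycleGraph_four_ne_iff.1 (hval φ)
    -- Some opposite pair agrees, so one recolouring makes the other pair agree too and yields an
    -- alternating colouring.
    have : ∀ a b c d : Fin 3, a ≠ b → b ≠ c → c ≠ d → d ≠ a → a = c ∨ b = d := by decide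
    refine SimpleGraph.Reachable.trans ?_ (hM (φ 0) (φ 1) h01)
    rcases this _ _ _ _ h01 h12 h23 h30 with h | h
    · refine localizedColoringGraph_one_reachable (v := 3) fun w => ?_
      fin_cases w <;> simp [M, cycleColoring_apply, h]
    · refine localizedColoringGraph_one_reachable (v := 2) fun w => ?_
      fin_cases w <;> simp [M, cycleColoring_apply, h]
  exact SimpleGraph.connected_iff_exists_forall_reachable _ |>.2 ⟨_, fun φ => (hbase φ).symm⟩

end FourCycle

/-! ### Independent sets on Hamiltonian cycles -/

theorem exists_perm_of_isHamiltonian {α : Type*} [DecidableEq α] [Fintype α] {G : SimpleGraph α}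
    (hG : G.IsHamiltonian) (hc : 2 < Fintype.card α) :
    ∃ σ : Equiv.Perm α, (∀ x, G.Adj x (σ x)) ∧ ∀ x y, ∃ k : ℕ, (σ ^ k) x = y := by
  obtain ⟨a, p, hp⟩ := hG (by omega)
  have hcyc := hp.isCycle
  cases p with
  | nil => exact absurd rfl hcyc.ne_nil
  | cons hab q =>
    have hq : q.IsHamiltonian := fun v => by simpa using hp.isHamiltonian_tail v
    have hn : q.support.Nodup := hq.isPath.support_nodup
    have hget : ∀ x, ∃ i, ∃ h : i < q.support.length, q.support[i] = x := fun x =>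
      List.getElem_of_mem (hq.mem_support x)
    refine ⟨q.support.formPerm, fun x => ?_, fun x y => ?_⟩
    · obtain ⟨i, hi, rfl⟩ := hget x
      rw [List.formPerm_apply_getElem _ hn]
      have hlen := q.length_support
      by_cases hi' : i + 1 < q.support.length
      · simp only [Nat.mod_eq_of_lt hi']
        exact List.isChain_iff_getElem.1 q.isChain_adj_support i hi'
      · have : i + 1 = q.support.length := by omega
        simp only [this, Nat.mod_self]
        convert hab using 1
        · obtain rfl : i = q.length := by omega
          simp
        · simp
    · obtain ⟨i, hi, rfl⟩ := hget x
      obtain ⟨j, hj, rfl⟩ := hget y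
      -- Going round past the end avoids truncation in `j - i`.
      refine ⟨j + (q.support.length - i), ?_⟩
      rw [List.formPerm_pow_apply_getElem _ hn]
      congr 1
      rw [show i + (j + (q.support.length - i)) = j + q.support.length by omega,
        Nat.add_mod_right, Nat.mod_eq_of_lt hj]

section Alternation

variable {α : Type*} [DecidableEq α] [Fintype α] {σ : Equiv.Perm α} {B : Finset α}

theorem card_le_card_compl_of_perm (hσ : ∀ x ∈ B, σ x ∉ B) : B.card ≤ Bᶜ.card :=
  Finset.card_le_card_of_injOn σ (fun x hx => by simpa using hσ x hx) σ.injective.injOn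

/-- By cardinality `σ` maps `B` onto its complement, so by injectivity nothing outside `B` can be
sent there. -/
theorem mem_of_notMem_of_perm (hσ : ∀ x ∈ B, σ x ∉ B) (hB : Bᶜ.card ≤ B.card) {x : α}
    (hx : x ∉ B) : σ x ∈ B := by
  have himage : B.image σ = Bᶜ := by
    refine Finset.eq_of_subset_of_card_le ?_ ?_
    · intro y hy
      obtain ⟨z, hz, rfl⟩ := Finset.mem_image.1 hy
      simpa using hσ z hz
    · rwa [Finset.card_image_of_injective _ σ.injective]
  by_contra hc
  have : σ x ∈ B.image σ := by rw [himage]; simpa using hc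
  obtain ⟨z, hz, hzx⟩ := Finset.mem_image.1 this
  exact hx (σ.injective hzx ▸ hz)

end Alternation

/-- The neighbours of a recoloured vertex share a colour, and the opposite vertex has one of the two
remaining colours: the old or the new one. -/
theorem fourCycle_recolor : ∀ a a' b c d : Fin 3,
    a ≠ a' ∧ a ≠ b ∧ b ≠ c ∧ c ≠ d ∧ d ≠ a ∧ a' ≠ b ∧ d ≠ a' → b = d ∧ (a = c ∨ a' = c) := by
  decide

theorem not_isHamiltonian_cycleGraph_four :
    ¬ (localizedColoringGraph (SimpleGraph.cycleGraph 4) 3 1).IsHamiltonian := by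
  intro hG
  have hval : ∀ φ : (SimpleGraph.cycleGraph 4).Coloring (Fin 3),
      φ 0 ≠ φ 1 ∧ φ 1 ≠ φ 2 ∧ φ 2 ≠ φ 3 ∧ φ 3 ≠ φ 0 := fun φ =>
    cycleGraph_four_ne_iff.1 fun i => φ.valid (cycleGraph_adj_add_one (m := 2) i)
  let φ₀ : (SimpleGraph.cycleGraph 4).Coloring (Fin 3) := cycleColoring (m := 2) ![0, 1, 0, 1]
    (cycleGraph_four_ne_iff.2 (by decide))
  obtain ⟨σ, hσ, -⟩ := exists_perm_of_isHamiltonian hG (two_lt_card_coloring φ₀)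
  -- The colourings with three colours: 12 of 18, and no two adjacent by `fourCycle_recolor`.
  let B : Finset ((SimpleGraph.cycleGraph 4).Coloring (Fin 3)) := {φ | φ 0 ≠ φ 2 ∨ φ 1 ≠ φ 3}
  have hcard : ∀ (R : (Fin 4 → Fin 3) → Prop) [DecidablePred R],
      (Finset.univ.filter fun φ : (SimpleGraph.cycleGraph 4).Coloring (Fin 3) => R φ).card =
      (Finset.univ.filter fun f : Fin 4 → Fin 3 =>
        (f 0 ≠ f 1 ∧ f 1 ≠ f 2 ∧ f 2 ≠ f 3 ∧ f 3 ≠ f 0) ∧ R f).card := by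
    intro R _
    refine Finset.card_bij (fun φ _ => φ) ?_ ?_ ?_
    · intro φ hφ
      simpa [hval φ] using hφ
    · exact fun φ _ ψ _ h => DFunLike.coe_injective h
    · intro f hf
      simp only [Finset.mem_filter, Finset.mem_univ, true_and] at hf
      exact ⟨cycleColoring (m := 2) f (cycleGraph_four_ne_iff.2 hf.1), 
        Finset.mem_filter.2 ⟨Finset.mem_univ _, hf.2⟩, rfl⟩
  have hle := card_le_card_compl_of_perm (σ := σ) (B := B) (by
    intro φ hφ hψ
    simp only [B, Finset.mem_filter, Finset.mem_univ, true_and] at hφ hψ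
    obtain ⟨v, hv, h⟩ := exists_of_localizedColoringGraph_one_adj (hσ φ)
    obtain ⟨a1, a2, a3, a4⟩ := hval φ
    obtain ⟨b1, b2, b3, b4⟩ := hval (σ φ)
    generalize σ φ = ψ at *
    have key := fourCycle_recolor
    fin_cases v
    · have h1 := h 1 (by decide); have h2 := h 2 (by decide); have h3 := h 3 (by decide)
      grind
    · have h0 := h 0 (by decide); have h2 := h 2 (by decide); have h3 := h 3 (by decide)
      grind
    · have h0 := h 0 (by decide); have h1 := h 1 (by decide); have h3 := h 3 (by decide)
      grind
    · have h0 := h 0 (by decide); have h1 := h 1 (by decide); have h2 := h 2 (by decide)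
      grind)
  have hB : B.card = 12 := by
    rw [hcard fun f => f 0 ≠ f 2 ∨ f 1 ≠ f 3]
    decide +kernel
  have hBc : Bᶜ.card = 6 := by
    rw [Finset.compl_filter, hcard fun f => ¬ (f 0 ≠ f 2 ∨ f 1 ≠ f 3)]
    decide +kernel
  omega

/-! ### Hamiltonian paths in hypercubes -/

section Cube

/-- Two Boolean words differ in exactly one letter. -/
def flipOne : List Bool → List Bool → Prop
  | a :: l, b :: m => (a ≠ b ∧ l = m) ∨ (a = b ∧ flipOne l m)
  | _, _ => False

theorem flipOne_of_head_ne {a b : Bool} (hab : a ≠ b) (l : List Bool) :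
    flipOne (a :: l) (b :: l) :=
  Or.inl ⟨hab, rfl⟩

/-- The parity of the number of letters `true` of a Boolean word. -/
def boolParity : List Bool → Bool
  | [] => false
  | a :: l => xor a (boolParity l)

theorem boolParity_ne_of_flipOne {l m : List Bool} (h : flipOne l m) :
    boolParity l ≠ boolParity m := by
  induction l generalizing m with
  | nil => simp [flipOne] at h
  | cons a l ih =>
    cases m with
    | nil => simp [flipOne] at h
    | cons b m =>
      rcases h with ⟨h, rfl⟩ | ⟨rfl, h⟩
      · simpa [boolParity] using h
      · simpa [boolParity] using ih h

theorem length_setOf_succ_eq {d : ℕ} {a b : Bool} (hab : a ≠ b) :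
    {l : List Bool | l.length = d + 1} =
      List.cons a '' {l | l.length = d} ∪ List.cons b '' {l | l.length = d} := by
  ext l
  constructor
  · intro hl
    cases l with
    | nil => simp at hl
    | cons c l =>
      have hl : l.length = d := by simpa using hl
      have : c = a ∨ c = b := by revert hab; cases a <;> cases b <;> cases c <;> simp
      rcases this with rfl | rfl
      · exact .inl ⟨l, hl, rfl⟩
      · exact .inr ⟨l, hl, rfl⟩
  · rintro (⟨l, hl, rfl⟩ | ⟨l, hl, rfl⟩) <;> simpa using hl

theorem disjoint_image_cons_bool {a b : Bool} (hab : a ≠ b) (S T : Set (List Bool)) :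
    Disjoint (List.cons a '' S) (List.cons b '' T) := by
  rw [Set.disjoint_left]
  rintro _ ⟨l, _, rfl⟩ ⟨m, _, h⟩
  exact hab (List.cons.inj h).1.symm

theorem HamPath.map_cons_bool {S : Set (List Bool)} {x y : List Bool} (a : Bool)
    (h : HamPath flipOne S x y) : HamPath flipOne (List.cons a '' S) (a :: x) (a :: y) :=
  h.map _ (fun _ _ _ _ h => List.cons_injective h) fun _ _ _ _ h => .inr ⟨rfl, h⟩

/-- In a hypercube, any two vertices of different parity are the ends of a Hamiltonian path. -/
theorem hamPath_cube {d : ℕ} {x y : List Bool} (hx : x.length = d) (hy : y.length = d)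
    (hxy : boolParity x ≠ boolParity y) : HamPath flipOne {l | l.length = d} x y := by
  induction d generalizing x y with
  | zero =>
    rw [List.length_eq_zero_iff] at hx hy
    exact absurd rfl (hx ▸ hy ▸ hxy)
  | succ d ih =>
    obtain ⟨a, x, rfl⟩ := List.exists_cons_of_length_eq_add_one hx
    obtain ⟨b, y, rfl⟩ := List.exists_cons_of_length_eq_add_one hy
    simp only [List.length_cons, Nat.add_right_cancel_iff] at hx hy
    by_cases hab : a = b
    -- Replace the first edge `x`, `u` of a path in one face by a detour through the whole opposite
    -- face.
    · subst hab
      have hne : (!a) ≠ a := by simp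
      have hp := ih hx hy (by simpa [boolParity] using hxy)
      rw [length_setOf_succ_eq hne]
      generalize hS : {l : List Bool | l.length = d} = S at hp ⊢
      cases hp with
      | single => simp at hxy
      | @cons _ u _ S hxS hxu h =>
        have hu : u.length = d := by
          have : u ∈ {l : List Bool | l.length = d} := hS ▸ .inr h.left_mem
          exact this
        have hblock := (ih hx hu (boolParity_ne_of_flipOne hxu)).map_cons_bool (!a)
        rw [hS] at hblock
        have h1 := hblock.append (flipOne_of_head_ne hne _) (h.map_cons_bool a)
          (disjoint_image_cons_bool hne _ _)
        rw [Set.image_insert_eq (f := List.cons a), Set.union_insert]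
        refine .cons ?_ (flipOne_of_head_ne hne.symm _) h1
        rintro (⟨l, -, hl⟩ | ⟨l, hl, hl'⟩)
        · exact hne (List.cons.inj hl).1
        · exact hxS ((List.cons.inj hl').2 ▸ hl)
    · rw [length_setOf_succ_eq hab]
      have hpar : boolParity x = boolParity y := by
        revert hxy hab
        simp only [boolParity]
        cases a <;> cases b <;> cases boolParity x <;> cases boolParity y <;> simp
      -- The path crosses faces at `z`, of parity opposite to `x` and `y`; in dimension 0 the face
      -- is a single point.
      obtain ⟨z, hz⟩ : ∃ z, HamPath flipOne {l | l.length = d} x z ∧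
          HamPath flipOne {l | l.length = d} z y := by
        cases d with
        | zero =>
          rw [List.length_eq_zero_iff] at hx hy
          subst hx hy
          have : {l : List Bool | l.length = 0} = {[]} := by ext; simp
          rw [this]
          exact ⟨[], .single _, .single _⟩
        | succ d =>
          obtain ⟨c, t, rfl⟩ := List.exists_cons_of_length_eq_add_one hx
          have hc : boolParity (c :: t) ≠ boolParity ((!c) :: t) := by simp [boolParity]
          exact ⟨(!c) :: t, ih hx (by simpa using hx) hc, ih (by simpa using hx) hy (hpar ▸ hc.symm)⟩
      exact (hz.1.map_cons_bool a).append (flipOne_of_head_ne hab _) (hz.2.map_cons_bool b)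
        (disjoint_image_cons_bool hab _ _)

theorem boolParity_replicate_false (k : ℕ) : boolParity (List.replicate k false) = false := by
  induction k with
  | zero => rfl
  | succ k ih => simpa [List.replicate_succ, boolParity] using ih

theorem boolParity_replicate_true (k : ℕ) : boolParity (List.replicate (2 * k) true) = false := by
  induction k with
  | zero => rfl
  | succ k ih => simpa [Nat.mul_succ, List.replicate_succ, boolParity] using ih

theorem exists_of_flipOne {l m : List Bool} (h : flipOne l m) :
    ∃ k < l.length, ∀ i, i ≠ k → l[i]? = m[i]? := by
  induction l generalizing m with
  | nil => simp [flipOne] at h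
  | cons a l ih =>
    cases m with
    | nil => simp [flipOne] at h
    | cons b m =>
      rcases h with ⟨-, rfl⟩ | ⟨rfl, h⟩
      · refine ⟨0, by simp, fun i hi => ?_⟩
        obtain ⟨j, rfl⟩ := Nat.exists_eq_succ_of_ne_zero hi
        simp
      · obtain ⟨k, hk, h⟩ := ih h
        refine ⟨k + 1, by simpa using hk, fun i hi => ?_⟩
        cases i with
        | zero => simp
        | succ i => simpa using h i (by omega)

end Cube

/-! ### Colourings of stars -/

section Star

variable {d : ℕ}

/-- The colouring of a star with centre colour `c` and leaf colours `f`. -/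
def starColoring (c : Fin 3) (f : Fin d → Fin 3) (hf : ∀ i, f i ≠ c) :
    (completeBipartiteGraph (Fin 1) (Fin d)).Coloring (Fin 3) :=
  SimpleGraph.Coloring.mk (Sum.elim (fun _ => c) f) fun {u v} h => by
    rcases u with u | u <;> rcases v with v | v <;> simp at h ⊢
    · exact (hf v).symm
    · exact hf u

@[simp]
theorem starColoring_inl (c : Fin 3) (f : Fin d → Fin 3) (hf : ∀ i, f i ≠ c) (j : Fin 1) :
    starColoring c f hf (.inl j) = c := rfl

@[simp]
theorem starColoring_inr (c : Fin 3) (f : Fin d → Fin 3) (hf : ∀ i, f i ≠ c) (i : Fin d) :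
    starColoring c f hf (.inr i) = f i := rfl

theorem star_adj (i : Fin d) :
    (completeBipartiteGraph (Fin 1) (Fin d)).Adj (.inl 0) (.inr i) := by
  simp

theorem star_leaf_ne (φ : (completeBipartiteGraph (Fin 1) (Fin d)).Coloring (Fin 3)) (i : Fin d) :
    φ (.inr i) ≠ φ (.inl 0) := (φ.valid (star_adj i)).symm

theorem star_ext {φ ψ : (completeBipartiteGraph (Fin 1) (Fin d)).Coloring (Fin 3)}
    (h0 : φ (.inl 0) = ψ (.inl 0)) (h : ∀ i, φ (.inr i) = ψ (.inr i)) : φ = ψ := by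
  refine DFunLike.ext _ _ fun v => ?_
  rcases v with v | v
  · rw [Subsingleton.elim v 0, h0]
  · exact h v

/-- Leaves can be recoloured one by one to a common colour; then the centre is free to change. -/
theorem connected_star (d : ℕ) :
    (localizedColoringGraph (completeBipartiteGraph (Fin 1) (Fin d)) 3 1).Connected := by
  set G := localizedColoringGraph (completeBipartiteGraph (Fin 1) (Fin d)) 3 1
  let M : (a b : Fin 3) → a ≠ b → (completeBipartiteGraph (Fin 1) (Fin d)).Coloring (Fin 3) :=
    fun a b hab => starColoring a (fun _ => b) fun _ => hab.symm
  have hleaves : ∀ φ b (hb : φ (.inl 0) ≠ b), G.Reachable φ (M (φ (.inl 0)) b hb) := by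
    intro φ b hb
    have hs : ∀ s : Finset (Fin d), G.Reachable φ (starColoring (φ (.inl 0))
        (fun i => if i ∈ s then b else φ (.inr i)) fun i => by
          split_ifs
          exacts [hb.symm, star_leaf_ne φ i]) := by
      intro s
      induction s using Finset.induction_on with
      | empty =>
        convert SimpleGraph.Reachable.refl φ using 1
        exact star_ext (by simp) (by simp)
      | insert j s hj ih =>
        refine ih.trans (localizedColoringGraph_one_reachable (v := .inr j) fun w hw => ?_)
        rcases w with w | w
        · simp at hw
        · by_contra hc
          have : w ≠ j := fun h => hc (by rw [h])
          simp [this] at hw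
    convert hs Finset.univ using 1
    exact star_ext (by simp [M]) (by simp [M])
  have hright : ∀ a b c hab hac, G.Reachable (M a b hab) (M a c hac) :=
    fun a b c hab hac => hleaves (M a b hab) c hac
  have hleft : ∀ a b c hab hcb, G.Reachable (M a b hab) (M c b hcb) := by
    intro a b c hab hcb
    refine localizedColoringGraph_one_reachable (v := .inl 0) fun w hw => ?_
    rcases w with w | w
    · rw [Subsingleton.elim w 0]
    · simp [M] at hw
  have hM := reachable_of_pairs M hright hleft
  refine SimpleGraph.connected_iff_exists_forall_reachable _ |>.2
    ⟨M 0 1 (by decide), fun φ => SimpleGraph.Reachable.symm ?_⟩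
  exact (hleaves φ (φ (.inl 0) + 1) (fin_three_add_one_ne _).symm).trans (hM _ _ (fin_three_add_one_ne _).symm)

/-- The sign of the number of leaves whose colour follows that of the centre. -/
def starSign (φ : (completeBipartiteGraph (Fin 1) (Fin d)).Coloring (Fin 3)) : ℤ :=
  ∏ i, if φ (.inr i) = φ (.inl 0) + 1 then -1 else 1

theorem starSign_eq_or (φ : (completeBipartiteGraph (Fin 1) (Fin d)).Coloring (Fin 3)) :
    starSign φ = 1 ∨ starSign φ = -1 := by
  refine Finset.prod_induction _ (fun z : ℤ => z = 1 ∨ z = -1) ?_ (.inl rfl) ?_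
  · rintro a b (rfl | rfl) (rfl | rfl) <;> simp
  · intro i _
    split_ifs <;> simp

theorem fin_three_eq_add_one_iff : ∀ {a b c : Fin 3}, a ≠ c → b ≠ c → a ≠ b →
    (a = c + 1 ↔ b ≠ c + 1) := by decide

theorem starSign_eq_neg {φ ψ : (completeBipartiteGraph (Fin 1) (Fin d)).Coloring (Fin 3)}
    {i : Fin d} (hi : φ (.inr i) ≠ ψ (.inr i)) (h : ∀ w, w ≠ .inr i → φ w = ψ w) :
    starSign ψ = -starSign φ := by
  have h0 := h (.inl 0) (by simp)
  have hrest : ∏ j ∈ Finset.univ.erase i, (if φ (.inr j) = φ (.inl 0) + 1 then -1 else 1 : ℤ) =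
      ∏ j ∈ Finset.univ.erase i, (if ψ (.inr j) = ψ (.inl 0) + 1 then -1 else 1 : ℤ) :=
    Finset.prod_congr rfl fun j hj => by
      rw [h0, h (.inr j) (by simpa using Finset.ne_of_mem_erase hj)]
  have hiff := fin_three_eq_add_one_iff (star_leaf_ne φ i) (h0 ▸ star_leaf_ne ψ i) hi
  rw [starSign, starSign, ← Finset.mul_prod_erase _ _ (Finset.mem_univ i),
    ← Finset.mul_prod_erase _ _ (Finset.mem_univ i), hrest, ← h0]
  by_cases hc : ψ (.inr i) = φ (.inl 0) + 1 <;> simp [hiff, hc]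

theorem starSign_eq_one_of_leaves {φ : (completeBipartiteGraph (Fin 1) (Fin d)).Coloring (Fin 3)}
    (hd : Even d) {a : Fin 3} (h : ∀ i, φ (.inr i) = a) : starSign φ = 1 := by
  simp only [starSign, h, Finset.prod_const, Finset.card_univ, Fintype.card_fin]
  split_ifs
  · exact hd.neg_one_pow
  · simp

/-- Recolouring the centre of a star is only possible if all leaves have the same colour. -/
theorem starSign_eq_one_of_center {φ ψ : (completeBipartiteGraph (Fin 1) (Fin d)).Coloring (Fin 3)}
    (hd : Even d) (h0 : φ (.inl 0) ≠ ψ (.inl 0)) (h : ∀ i, φ (.inr i) = ψ (.inr i)) :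
    starSign φ = 1 := by
  -- The three colours sum to `0`, so this is the third colour.
  refine starSign_eq_one_of_leaves hd (a := -(φ (.inl 0) + ψ (.inl 0))) fun i => ?_
  have h1 := star_leaf_ne φ i
  have h2 := star_leaf_ne ψ i
  rw [← h] at h2
  have : ∀ a b c : Fin 3, a ≠ b → c ≠ a → c ≠ b → c = -(a + b) := by decide
  exact this _ _ _ h0 h1 h2

/-- Change the colour of a leaf of a star without changing that of the centre. -/
def flipLeaf (i : Fin d) (φ : (completeBipartiteGraph (Fin 1) (Fin d)).Coloring (Fin 3)) :
    (completeBipartiteGraph (Fin 1) (Fin d)).Coloring (Fin 3) :=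
  starColoring (φ (.inl 0))
    (fun j => if j = i then -(φ (.inl 0) + φ (.inr j)) else φ (.inr j)) fun j => by
      have : ∀ a b : Fin 3, b ≠ a → -(a + b) ≠ a := by decide
      split_ifs
      exacts [this _ _ (star_leaf_ne φ j), star_leaf_ne φ j]

theorem flipLeaf_flipLeaf (i : Fin d)
    (φ : (completeBipartiteGraph (Fin 1) (Fin d)).Coloring (Fin 3)) :
    flipLeaf i (flipLeaf i φ) = φ := by
  have : ∀ a b : Fin 3, -(a + -(a + b)) = b := by decide
  refine star_ext rfl fun j => ?_
  simp only [flipLeaf, starColoring_inl, starColoring_inr]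
  split_ifs
  · exact this _ _
  · rfl

theorem starSign_flipLeaf (i : Fin d)
    (φ : (completeBipartiteGraph (Fin 1) (Fin d)).Coloring (Fin 3)) :
    starSign (flipLeaf i φ) = -starSign φ := by
  have : ∀ a b : Fin 3, b ≠ a → b ≠ -(a + b) := by decide
  refine starSign_eq_neg (i := i) ?_ ?_
  · simpa [flipLeaf] using this _ _ (star_leaf_ne φ i)
  · intro w hw
    rcases w with w | w
    · rw [Subsingleton.elim w 0]; rfl
    · have : w ≠ i := fun h => hw (by rw [h])
      simp [flipLeaf, this]

theorem not_isHamiltonian_star (hd : Even d) (hd0 : 0 < d) :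
    ¬ (localizedColoringGraph (completeBipartiteGraph (Fin 1) (Fin d)) 3 1).IsHamiltonian := by
  intro hG
  let φ₀ : (completeBipartiteGraph (Fin 1) (Fin d)).Coloring (Fin 3) :=
    starColoring 0 (fun _ => 1) (by simp)
  obtain ⟨σ, hσ, horbit⟩ := exists_perm_of_isHamiltonian hG (two_lt_card_coloring φ₀)
  let B : Finset ((completeBipartiteGraph (Fin 1) (Fin d)).Coloring (Fin 3)) :=
    {φ | starSign φ = -1}
  have hB : ∀ φ, φ ∈ B ↔ starSign φ = -1 := by simp [B]
  have hleaf : ∀ φ, (φ ∈ B ∨ σ φ ∈ B) →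
      starSign (σ φ) = -starSign φ ∧ (σ φ) (.inl 0) = φ (.inl 0) := by
    intro φ hφ
    obtain ⟨v, hv, h⟩ := exists_of_localizedColoringGraph_one_adj (hσ φ)
    rcases v with v | i
    · obtain rfl := Subsingleton.elim v 0
      have h1 := starSign_eq_one_of_center hd hv fun i => h (.inr i) (by simp)
      have h2 := starSign_eq_one_of_center hd hv.symm fun i => (h (.inr i) (by simp)).symm
      rw [hB, hB, h1, h2] at hφ
      norm_num at hφ
    · exact ⟨starSign_eq_neg hv h, (h _ (by simp)).symm⟩
  have hind : ∀ φ ∈ B, σ φ ∉ B := by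
    intro φ hφ hσφ
    have := (hleaf φ (.inl hφ)).1
    rw [hB] at hφ hσφ
    rw [hφ, hσφ] at this
    norm_num at this
  -- Flipping a leaf is an involution that reverses the sign.
  have hcard : Bᶜ.card ≤ B.card := by
    refine Finset.card_le_card_of_injOn (flipLeaf ⟨0, hd0⟩) ?_ ?_
    · intro φ hφ
      have hφ : φ ∉ B := by simpa using hφ
      rw [hB] at hφ
      have := (starSign_eq_or φ).resolve_right hφ
      exact (hB _).2 (by rw [starSign_flipLeaf, this])
    · exact (Function.Involutive.injective (flipLeaf_flipLeaf _)).injOn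
  -- The cycle alternates between `B` and its complement, so each edge meets `B` and must recolour a
  -- leaf.
  have hcenter : ∀ φ, (σ φ) (.inl 0) = φ (.inl 0) := fun φ => (hleaf φ (by
    by_cases hφ : φ ∈ B
    · exact .inl hφ
    · exact .inr (mem_of_notMem_of_perm hind hcard hφ))).2
  have hpow : ∀ k : ℕ, ∀ φ, ((σ ^ k) φ) (.inl 0) = φ (.inl 0) := by
    intro k
    induction k with
    | zero => simp
    | succ k ih => intro φ; rw [pow_succ', Equiv.Perm.mul_apply, hcenter, ih]
  obtain ⟨k, hk⟩ := horbit φ₀ (shiftColoring φ₀ 1)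
  have := hpow k φ₀
  rw [hk] at this
  exact absurd this (fin_three_add_one_ne (φ₀ (.inl 0)))

/-- A colouring of a star as the colour of its centre and a Boolean word. -/
def starCode (φ : (completeBipartiteGraph (Fin 1) (Fin d)).Coloring (Fin 3)) :
    Fin 3 × List Bool :=
  (φ (.inl 0), List.ofFn fun i => decide (φ (.inr i) = φ (.inl 0) + 1))

/-- The steps of the Hamiltonian cycle on the colourings of a star with `k + 1` leaves. -/
def starStep (k : ℕ) (p q : Fin 3 × List Bool) : Prop :=
  (p.1 = q.1 ∧ flipOne p.2 q.2) ∨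
    (q.1 = p.1 + 2 ∧ p.2 = false :: List.replicate k true ∧ q.2 = List.replicate (k + 1) false)

theorem fin_three_eq_of_iff : ∀ {a b c : Fin 3}, a ≠ c → b ≠ c →
    decide (a = c + 1) = decide (b = c + 1) → a = b := by decide

theorem starCode_injective : Function.Injective (starCode (d := d)) := by
  intro φ ψ h
  obtain ⟨h0, h1⟩ := Prod.mk.inj h
  have h1 := List.ofFn_injective h1
  refine star_ext h0 fun i => ?_
  have := congrFun h1 i
  simp only [← h0] at this
  exact fin_three_eq_of_iff (star_leaf_ne φ i) (h0 ▸ star_leaf_ne ψ i) this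

theorem exists_starCode_eq (c : Fin 3) {l : List Bool} (hl : l.length = d) :
    ∃ φ : (completeBipartiteGraph (Fin 1) (Fin d)).Coloring (Fin 3), starCode φ = (c, l) := by
  subst hl
  refine ⟨starColoring c (fun i => if l[i] then c + 1 else c + 2) fun i => ?_, ?_⟩
  · split_ifs <;> decide +revert
  · simp only [starCode, starColoring_inl, starColoring_inr]
    exact Prod.ext rfl (List.ext_getElem (by simp) (by simp))

/-- When the centre goes from `c` to `c + 2`, the letter `true` before and `false` after both mean
colour `c + 1`; only the centre and the first leaf change. -/
theorem localizedColoringGraph_two_adj_of_starStep {k : ℕ}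
    {φ ψ : (completeBipartiteGraph (Fin 1) (Fin (k + 1))).Coloring (Fin 3)} (hne : φ ≠ ψ)
    (h : starStep k (starCode φ) (starCode ψ)) :
    (localizedColoringGraph (completeBipartiteGraph (Fin 1) (Fin (k + 1))) 3 2).Adj φ ψ := by
  rcases h with ⟨h0, h⟩ | ⟨h0, h1, h2⟩
  · have h0 : φ (.inl 0) = ψ (.inl 0) := h0
    obtain ⟨i, hi, h⟩ := exists_of_flipOne h
    simp only [starCode, List.length_ofFn] at hi
    refine localizedColoringGraph_two_adj (star_adj ⟨i, hi⟩) hne fun w hw => ?_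
    rcases w with w | w
    · rw [Subsingleton.elim w 0] at hw
      exact absurd h0 hw
    · right
      by_contra hc
      have hwi : (w : ℕ) ≠ i := fun e => hc (congrArg Sum.inr (Fin.ext e))
      have := h w hwi
      simp only [starCode, List.getElem?_ofFn, w.isLt, dite_true, Fin.eta, Option.some.injEq,
        ← h0] at this
      exact hw (fin_three_eq_of_iff (star_leaf_ne φ w) (h0 ▸ star_leaf_ne ψ w) this)
  · refine localizedColoringGraph_two_adj (star_adj 0) hne fun w hw => ?_
    rcases w with w | w
    · exact .inl (by rw [Subsingleton.elim w 0])
    · right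
      by_contra hc
      obtain ⟨j, rfl⟩ := Fin.exists_succ_eq.2 fun h => hc (congrArg Sum.inr h)
      have e1 := congrArg (fun l : List Bool => l[(j : ℕ) + 1]?) h1
      have e2 := congrArg (fun l : List Bool => l[(j : ℕ) + 1]?) h2
      have h0 : ψ (.inl 0) = φ (.inl 0) + 2 := h0
      have hψ := star_leaf_ne ψ j.succ
      simp [starCode] at e1 e2
      have : ∀ a b c c' : Fin 3, a = c + 1 → c' = c + 2 → b ≠ c' → b ≠ c' + 1 → a = b := by decide
      exact hw (this _ _ _ _ e1 h0 hψ e2)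

theorem isHamiltonian_star {m : ℕ} (hm : 1 ≤ m) :
    (localizedColoringGraph (completeBipartiteGraph (Fin 1) (Fin (2 * m))) 3 2).IsHamiltonian := by
  obtain ⟨n, rfl⟩ : ∃ n, m = n + 1 := ⟨m - 1, by omega⟩
  let k := 2 * n + 1
  -- Evenness of the number of leaves makes `k` odd, so the two ends have opposite parity.
  have hpar : boolParity (List.replicate (k + 1) false) ≠
      boolParity (false :: List.replicate k true) := by
    rw [boolParity_replicate_false]
    simp [k, boolParity, List.replicate_succ, boolParity_replicate_true]
  have hblock : ∀ c : Fin 3, HamPath (starStep k) (Prod.mk c '' {l | l.length = k + 1})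
      (c, List.replicate (k + 1) false) (c, false :: List.replicate k true) := fun c =>
    (hamPath_cube (by simp) (by simp) hpar).map (Prod.mk c)
      (fun _ _ _ _ h => (Prod.mk.inj h).2) fun _ _ _ _ h => .inl ⟨rfl, h⟩
  have hdisj : ∀ {c c' : Fin 3}, c ≠ c' → Disjoint (Prod.mk c '' {l : List Bool | l.length = k + 1})
      (Prod.mk c' '' {l | l.length = k + 1}) := by
    intro c c' hcc
    rw [Set.disjoint_left]
    rintro _ ⟨l, _, rfl⟩ ⟨m, _, h⟩
    exact hcc (Prod.mk.inj h).1.symm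
  -- Each link adds 2 to the centre colour, giving the order 0, 2, 1 and back to 0.
  have h := ((hblock 0).append (.inr ⟨rfl, rfl, rfl⟩) (hblock 2) (hdisj (by decide))).append
    (.inr ⟨rfl, rfl, rfl⟩) (hblock 1) (by
      rw [Set.disjoint_union_left]
      exact ⟨hdisj (by decide), hdisj (by decide)⟩)
  have hS : ∀ p ∈ Prod.mk 0 '' {l : List Bool | l.length = k + 1} ∪
      Prod.mk 2 '' {l | l.length = k + 1} ∪ Prod.mk 1 '' {l | l.length = k + 1},
      ∃ φ : (completeBipartiteGraph (Fin 1) (Fin (k + 1))).Coloring (Fin 3), starCode φ = p := by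
    rintro p ((⟨l, hl, rfl⟩ | ⟨l, hl, rfl⟩) | ⟨l, hl, rfl⟩) <;> exact exists_starCode_eq _ hl
  obtain ⟨φ, hφ⟩ := hS _ h.left_mem
  obtain ⟨ψ, hψ⟩ := hS _ h.right_mem
  have hψφ : starStep k (starCode ψ) (starCode φ) := by
    rw [hφ, hψ]
    exact .inr ⟨rfl, rfl, rfl⟩
  rw [← hφ, ← hψ] at h
  have hp := h.comap (r' := (localizedColoringGraph
    (completeBipartiteGraph (Fin 1) (Fin (k + 1))) 3 2).Adj) starCode starCode_injective hS
    fun a b hab hn => localizedColoringGraph_two_adj_of_starStep hab hn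
  have huniv : ∀ S, S = starCode (d := k + 1) ⁻¹' (Prod.mk 0 '' {l : List Bool | l.length = k + 1} ∪
      Prod.mk 2 '' {l | l.length = k + 1} ∪ Prod.mk 1 '' {l | l.length = k + 1}) →
      S = Set.univ := by
    rintro _ rfl
    refine Set.eq_univ_of_forall fun φ => ?_
    have hlen : (starCode φ).2.length = k + 1 := List.length_ofFn
    rcases hc : starCode φ with ⟨c, l⟩
    rw [hc] at hlen
    have : ∀ c : Fin 3, c = 0 ∨ c = 2 ∨ c = 1 := by decide
    rw [Set.mem_preimage, hc]
    rcases this c with rfl | rfl | rfl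
    · exact .inl (.inl ⟨l, hlen, rfl⟩)
    · exact .inl (.inr ⟨l, hlen, rfl⟩)
    · exact .inr ⟨l, hlen, rfl⟩
  rw [huniv _ rfl] at hp
  exact isHamiltonian_of_hamPath hp
    (fun hne => localizedColoringGraph_two_adj_of_starStep hne hψφ) (two_lt_card_coloring φ)

end Star

/-! ### The values for cycles and even stars -/

theorem proposition2 :
    (∀ n : ℕ, 3 ≤ n → n ≠ 4 → colorMixingNumber (SimpleGraph.cycleGraph n) 3 = 2) ∧
    colorMixingNumber (SimpleGraph.cycleGraph 4) 3 = 1 ∧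
    (∀ n : ℕ, 3 ≤ n → colorGrayCodeNumber (SimpleGraph.cycleGraph n) 3 = 2) ∧
    (∀ m : ℕ, 1 ≤ m →
      colorMixingNumber (completeBipartiteGraph (Fin 1) (Fin (2 * m))) 3 = 1 ∧
      colorGrayCodeNumber (completeBipartiteGraph (Fin 1) (Fin (2 * m))) 3 = 2) := by
  refine ⟨fun n hn hn4 => ?_, ?_, fun n hn => ?_, fun m hm => ⟨?_, ?_⟩⟩
  · obtain ⟨m, rfl⟩ : ∃ m, n = m + 2 := ⟨n - 2, by omega⟩
    exact colorMixingNumber_eq_two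
      (isHamiltonian_localizedColoringGraph_cycleGraph (by omega)).connected
      (not_connected_cycleGraph (by omega) (by omega))
  · exact colorMixingNumber_eq_one (φ := cycleColoring (m := 2) ![0, 1, 0, 1] (by decide))
      (ψ := cycleColoring (m := 2) ![1, 0, 1, 0] (by decide)) connected_cycleGraph_four
      fun h => absurd (DFunLike.congr_fun h (0 : Fin 4)) (by decide)
  · obtain ⟨m, rfl⟩ : ∃ m, n = m + 2 := ⟨n - 2, by omega⟩
    refine colorGrayCodeNumber_eq_two
      (isHamiltonian_localizedColoringGraph_cycleGraph (by omega)) fun h => ?_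
    by_cases hm : m = 2
    · subst hm
      exact not_isHamiltonian_cycleGraph_four h
    · exact not_connected_cycleGraph (by omega) hm h.connected
  · exact colorMixingNumber_eq_one (φ := starColoring 0 (fun _ => 1) (by simp))
      (ψ := starColoring 1 (fun _ => 0) (by simp)) (connected_star _)
      fun h => absurd (DFunLike.congr_fun h (.inl 0)) (by simp)
  · exact colorGrayCodeNumber_eq_two (isHamiltonian_star hm)
      (not_isHamiltonian_star (even_two_mul m) (by omega))
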